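/- Let $S$ be a numerical semigroup, that is, a submonoid of $(\mathbb{N},+)$ (with $0\in\mathbb N$) whose complement in $\mathbb{N}$ is finite. The minimal generators of $S$ are the elements of its unique minimal generating system. For integers $a,b$ write $a\le_S b$ if $b-a\in S$. A factorization of $s\in S$ is a vector of non-negative integer coefficients, indexed by the minimal generators, that expresses $s$ as a combination of the minimal generators. Let $\nabla_s$ be the graph whose vertices are the factorizations of $s$, two distinct factorizations being joined by an edge if some minimal generator has a nonzero coefficient in both. An element $s\in S$ is a Betti element if $\nabla_s$ is not connected; $\operatorname{Betti}(S)$ is the set of Betti elements. The cyclotomic exponent sequence of $S$ is the unique sequence of integers $(e_j)_{j\ge1}$ such that $$(1-x)\sum_{s\in S}x^s=\prod_{j=1}^{\infty}(1-x^j)^{e_j}\quad\text{in }\mathbb{Z}[\![x]\!],$$ and $$\mathcal{E}(S)=\{d\in\mathbb{N}: d\ge2,\ e_d\ne0,\ d\text{ is not a minimal generator of }S\}.$$ The semigroup $S$ is called Betti-sorted if $\operatorname{Betti}(S)$ is totally ordered by $\le_S$, and Betti-divisible if $\operatorname{Betti}(S)$ is totally ordered by divisibility. Then: a) $S$ is Betti-sorted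 if and only if $\mathcal{E}(S)$ is totally ordered by $\le_S$, and in that case $\operatorname{Betti}(S)=\mathcal{E}(S)$. b) $S$ is Betti-divisible if and only if $\mathcal{E}(S)$ is totally ordered by divisibility. c) $S$ has a unique Betti element if and only if $\mathcal{E}(S)$ is a singleton. -/

import Mathlib

open scoped PowerSeries PowerSeries.WithPiTopology

namespace NumSgp

/-- A numerical semigroup: a submonoid of `(ℕ, +)` with finite complement. -/
def IsNumericalSemigroup (S : AddSubmonoid ℕ) : Prop := ((S : Set ℕ)ᶜ).Finite

/-- The minimal generators of `S`: the nonzero elements of `S` that are not the sum of two nonzero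
elements of `S`. By `isLeast_minimalGenerators` they form the least, hence the unique minimal,
generating system of `S`. -/
def minimalGenerators (S : AddSubmonoid ℕ) : Set ℕ :=
  {n | n ∈ S ∧ n ≠ 0 ∧ ∀ a ∈ S, ∀ b ∈ S, a ≠ 0 → b ≠ 0 → a + b ≠ n}

theorem isLeast_minimalGenerators (S : AddSubmonoid ℕ) :
    IsLeast {A : Set ℕ | AddSubmonoid.closure A = S} (minimalGenerators S) := by
  constructor
  · apply le_antisymm
    · rw [AddSubmonoid.closure_le]
      exact fun n hn => hn.1
    · intro n
      induction n using Nat.strong_induction_on with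
      | _ n ih =>
        intro hn
        by_cases h0 : n = 0
        · subst h0; exact zero_mem _
        by_cases hm : n ∈ minimalGenerators S
        · exact AddSubmonoid.subset_closure hm
        · simp only [minimalGenerators, Set.mem_ofPred_eq, not_and, not_forall] at hm
          obtain ⟨a, ha, b, hb, ha0, hb0, hab⟩ := hm hn h0
          have hab' : a + b = n := not_not.mp hab
          rw [← hab']
          exact add_mem (ih a (by omega) ha) (ih b (by omega) hb)
  · rintro A rfl n ⟨hn, h0, hirr⟩
    by_contra hnA
    have key : ∀ x ∈ AddSubmonoid.closure A, x ≠ n := by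
      intro x hx
      induction hx using AddSubmonoid.closure_induction with
      | mem x hx => rintro rfl; exact hnA hx
      | zero => exact fun h => h0 h.symm
      | add x y hx hy ihx ihy =>
        by_cases hx0 : x = 0
        · simpa [hx0] using ihy
        by_cases hy0 : y = 0
        · simpa [hy0] using ihx
        exact hirr x hx y hy hx0 hy0
    exact key n hn rfl

/-- The relation `a ≤_S b`, that is, `b - a ∈ S`. -/
def sLE (S : AddSubmonoid ℕ) (a b : ℕ) : Prop := ∃ s ∈ S, a + s = b

/-- The set `Z(s)` of factorizations of `s`: the vectors of coefficients, indexed by the minimal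
generators of `S`, of the expressions of `s` as a combination of minimal generators. -/
def Factorization (S : AddSubmonoid ℕ) (s : ℕ) : Type :=
  {z : minimalGenerators S →₀ ℕ // (z.sum fun n k => k * (n : ℕ)) = s}

/-- The graph `∇_s` on `Z(s)`: two distinct factorizations are joined if they have a minimal
generator in common (equivalently, if their dot product is nonzero). -/
def factorizationGraph (S : AddSubmonoid ℕ) (s : ℕ) : SimpleGraph (Factorization S s) where
  Adj x y := x ≠ y ∧ ∃ n : minimalGenerators S, x.1 n ≠ 0 ∧ y.1 n ≠ 0
  symm := ⟨fun _ _ h => ⟨h.1.symm, h.2.imp fun _ hn => ⟨hn.2, hn.1⟩⟩⟩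
  loopless := ⟨fun _ h => h.1 rfl⟩

/-- The Betti elements of `S`: the elements `s ∈ S` for which `∇_s` is not connected. -/
def bettiElements (S : AddSubmonoid ℕ) : Set ℕ :=
  {s | s ∈ S ∧ ¬ (factorizationGraph S s).Connected}

/-- `S` is Betti-sorted if its Betti elements are totally ordered by `≤_S`. -/
def IsBettiSorted (S : AddSubmonoid ℕ) : Prop := IsChain (sLE S) (bettiElements S)

/-- `S` is Betti-divisible if its Betti elements are totally ordered by divisibility. -/
def IsBettiDivisible (S : AddSubmonoid ℕ) : Prop := IsChain (· ∣ ·) (bettiElements S)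

/-- The Hilbert series `∑_{s ∈ S} x^s` in `ℤ⟦x⟧`. -/
noncomputable def hilbertSeries (S : AddSubmonoid ℕ) : ℤ⟦X⟧ :=
  open Classical in PowerSeries.mk fun n => if n ∈ S then 1 else 0

/-- The semigroup polynomial `(1 - x) ∑_{s ∈ S} x^s`, as an element of `ℤ⟦x⟧`. -/
noncomputable def semigroupPolynomial (S : AddSubmonoid ℕ) : ℤ⟦X⟧ :=
  (1 - PowerSeries.X) * hilbertSeries S

theorem isUnit_one_sub_X_pow (j : ℕ+) : IsUnit (1 - PowerSeries.X ^ (j : ℕ) : ℤ⟦X⟧) := by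
  rw [PowerSeries.isUnit_iff_constantCoeff]
  simp [j.ne_zero]

/-- `1 - x^j` as a unit of `ℤ⟦x⟧`, so that it has integer powers. -/
noncomputable def oneSubXPow (j : ℕ+) : ℤ⟦X⟧ˣ := (isUnit_one_sub_X_pow j).unit

/-- `e` is a cyclotomic exponent sequence of `S`: the formal identity
`P_S(x) = ∏_{j ≥ 1} (1 - x^j)^{e_j}` holds in `ℤ⟦x⟧`. The product converges coefficientwise
(`ℤ` is discrete and `ℤ⟦x⟧` has the product topology). -/
def IsCyclotomicExponentSequence (S : AddSubmonoid ℕ) (e : ℕ+ → ℤ) : Prop :=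
  HasProd (fun j : ℕ+ => ((oneSubXPow j ^ e j : ℤ⟦X⟧ˣ) : ℤ⟦X⟧)) (semigroupPolynomial S)

theorem dvd_prod_sub_one {ι : Type*} (s : Finset ι) (g : ι → ℤ⟦X⟧) (d : ℤ⟦X⟧)
    (h : ∀ i ∈ s, d ∣ g i - 1) : d ∣ (∏ i ∈ s, g i) - 1 := by
  classical
  induction s using Finset.induction_on with
  | empty => simp
  | insert a s ha ih =>
    rw [Finset.prod_insert ha]
    have h1 := h a (Finset.mem_insert_self a s)
    have h2 := ih fun i hi => h i (Finset.mem_insert_of_mem hi)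
    have : g a * ∏ i ∈ s, g i - 1 = (g a - 1) * ∏ i ∈ s, g i + ((∏ i ∈ s, g i) - 1) := by ring
    rw [this]
    exact dvd_add (h1.mul_right _) h2

/-- Convergence of an infinite product with factors `g j ≡ 1 mod x^j`, by congruences. -/
theorem hasProd_iff_dvd (g : ℕ+ → ℤ⟦X⟧) (a : ℤ⟦X⟧)
    (hg : ∀ j : ℕ+, PowerSeries.X ^ (j : ℕ) ∣ g j - 1) :
    HasProd g a ↔ ∀ n : ℕ,
      PowerSeries.X ^ (n + 1) ∣ a - ∏ k ∈ Finset.range n, g k.succPNat := by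
  classical
  have himg : ∀ n : ℕ, ∏ j ∈ (Finset.range n).image Nat.succPNat, g j =
      ∏ k ∈ Finset.range n, g k.succPNat := fun n =>
    Finset.prod_image fun x _ y _ h => Nat.succPNat_injective h
  have key : ∀ (n : ℕ) (s : Finset ℕ+), (Finset.range n).image Nat.succPNat ⊆ s →
      PowerSeries.X ^ (n + 1) ∣ ∏ j ∈ s, g j - ∏ k ∈ Finset.range n, g k.succPNat := by
    intro n s hs
    rw [← himg, ← Finset.prod_sdiff hs]
    have h1 : PowerSeries.X ^ (n + 1) ∣
        (∏ j ∈ s \ (Finset.range n).image Nat.succPNat, g j) - 1 := by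
      apply dvd_prod_sub_one
      intro j hj
      refine (pow_dvd_pow _ ?_).trans (hg j)
      by_contra hlt
      refine (Finset.mem_sdiff.mp hj).2 (Finset.mem_image.mpr ⟨j.natPred, ?_, ?_⟩)
      · have := j.pos
        have := PNat.natPred_add_one j
        simp only [Finset.mem_range]
        omega
      · exact PNat.succPNat_natPred j
    have h2 := h1.mul_right (∏ j ∈ (Finset.range n).image Nat.succPNat, g j)
    rwa [sub_mul, one_mul] at h2
  have hcoeff : ∀ s : Finset ℕ+, ∀ n : ℕ, (Finset.range n).image Nat.succPNat ⊆ s → ∀ m ≤ n,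
      PowerSeries.coeff m (∏ j ∈ s, g j) =
        PowerSeries.coeff m (∏ k ∈ Finset.range n, g k.succPNat) := by
    intro s n hs m hm
    have := PowerSeries.X_pow_dvd_iff.mp (key n s hs) m (by omega)
    rwa [map_sub, sub_eq_zero] at this
  unfold HasProd
  rw [PowerSeries.WithPiTopology.tendsto_iff_coeff_tendsto]
  simp only [nhds_discrete, Filter.tendsto_pure]
  constructor
  · intro h n
    rw [PowerSeries.X_pow_dvd_iff]
    intro m hm
    obtain ⟨s, hs⟩ := Filter.eventually_atTop.mp (h m)
    have h1 := hs (s ∪ (Finset.range n).image Nat.succPNat) Finset.subset_union_left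
    have h2 := hcoeff _ n (Finset.subset_union_right (s₁ := s)) m (by omega)
    rw [map_sub, sub_eq_zero, ← h1, h2]
  · intro h m
    refine Filter.eventually_atTop.mpr ⟨(Finset.range m).image Nat.succPNat, fun s hs => ?_⟩
    have h1 := PowerSeries.X_pow_dvd_iff.mp (h m) m (by omega)
    rw [map_sub, sub_eq_zero] at h1
    rw [hcoeff s m hs m le_rfl, h1]

theorem oneSubXPow_zpow (j : ℕ+) (e : ℤ) :
    PowerSeries.X ^ ((j : ℕ) + 1) ∣
      ((oneSubXPow j ^ e : ℤ⟦X⟧ˣ) : ℤ⟦X⟧) - (1 - (e : ℤ⟦X⟧) * PowerSeries.X ^ (j : ℕ)) := by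
  have hu : ((oneSubXPow j : ℤ⟦X⟧ˣ) : ℤ⟦X⟧) = 1 - PowerSeries.X ^ (j : ℕ) := rfl
  have hsq : (PowerSeries.X ^ ((j : ℕ) + 1) : ℤ⟦X⟧) ∣
      PowerSeries.X ^ (j : ℕ) * PowerSeries.X ^ (j : ℕ) := by
    rw [← pow_add]; exact pow_dvd_pow _ (by have := j.pos; omega)
  have hinv := (oneSubXPow j).inv_mul
  rw [hu] at hinv
  induction e using Int.induction_on with
  | zero => simp
  | succ i ih =>
    rw [zpow_add_one, Units.val_mul, hu]
    have := dvd_add (ih.mul_right (1 - PowerSeries.X ^ (j : ℕ)))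
      (hsq.mul_right (((i : ℤ) : ℤ⟦X⟧)))
    convert this using 1
    push_cast
    ring
  | pred i ih =>
    rw [zpow_sub_one, Units.val_mul]
    set w : ℤ⟦X⟧ := (((oneSubXPow j)⁻¹ : ℤ⟦X⟧ˣ) : ℤ⟦X⟧)
    have := dvd_add (ih.mul_right w)
      (hsq.mul_right (w * (((i : ℤ) : ℤ⟦X⟧) + 1)))
    convert this using 1
    push_cast
    linear_combination (1 + ((i : ℤ⟦X⟧) + 1) * PowerSeries.X ^ (j : ℕ)) * hinv

theorem isCyclotomicExponentSequence_iff (S : AddSubmonoid ℕ) (e : ℕ+ → ℤ) :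
    IsCyclotomicExponentSequence S e ↔ ∀ n : ℕ, PowerSeries.X ^ (n + 1) ∣
      semigroupPolynomial S -
        ∏ k ∈ Finset.range n, ((oneSubXPow k.succPNat ^ e k.succPNat : ℤ⟦X⟧ˣ) : ℤ⟦X⟧) := by
  refine hasProd_iff_dvd _ _ fun j => ?_
  have h1 := (pow_dvd_pow PowerSeries.X (Nat.le_succ (j : ℕ))).trans (oneSubXPow_zpow j (e j))
  have h2 : (PowerSeries.X ^ (j : ℕ) : ℤ⟦X⟧) ∣ ((e j : ℤ) : ℤ⟦X⟧) * PowerSeries.X ^ (j : ℕ) :=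
    dvd_mul_left _ _
  convert dvd_sub h1 h2 using 1
  ring

/-- Every submonoid of `ℕ` has exactly one cyclotomic exponent sequence. -/
theorem existsUnique_cyclotomicExponentSequence (S : AddSubmonoid ℕ) :
    ∃! e : ℕ+ → ℤ, IsCyclotomicExponentSequence S e := by
  simp only [isCyclotomicExponentSequence_iff]
  apply existsUnique_of_exists_of_unique
  · -- `Q n` is the quotient of the polynomial by the first `n` factors
    let Q : ℕ → ℤ⟦X⟧ := fun n => Nat.rec (semigroupPolynomial S) (fun n q =>
      q * ((oneSubXPow n.succPNat ^ (PowerSeries.coeff (n + 1) q) : ℤ⟦X⟧ˣ) : ℤ⟦X⟧)) n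
    have hQ : ∀ n, Q (n + 1) = Q n *
      ((oneSubXPow n.succPNat ^ (PowerSeries.coeff (n + 1) (Q n)) : ℤ⟦X⟧ˣ) : ℤ⟦X⟧) :=
      fun n => rfl
    have hQ1 : ∀ n, PowerSeries.X ^ (n + 1) ∣ Q n - 1 := by
      intro n
      induction n with
      | zero =>
        change PowerSeries.X ^ (0 + 1) ∣ semigroupPolynomial S - 1
        rw [zero_add, pow_one, PowerSeries.X_dvd_iff]
        simp [semigroupPolynomial, hilbertSeries]
      | succ n ih =>
        obtain ⟨r, hr⟩ := ih
        obtain ⟨t, ht⟩ := oneSubXPow_zpow n.succPNat (PowerSeries.coeff (n + 1) (Q n))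
        set c : ℤ := PowerSeries.coeff (n + 1) (Q n) with hc
        simp only [Nat.succPNat_coe, Nat.succ_eq_add_one] at ht
        have hcr : PowerSeries.constantCoeff r = c := by
          have : Q n = 1 + PowerSeries.X ^ (n + 1) * r := by rw [← hr]; ring
          rw [hc, this, map_add, PowerSeries.coeff_X_pow_mul', PowerSeries.coeff_one]
          simp
        have hr' : PowerSeries.X ∣ r - (c : ℤ⟦X⟧) := by
          rw [PowerSeries.X_dvd_iff, map_sub, hcr]
          simp
        obtain ⟨r', hr'⟩ := hr'
        rw [hQ, ← hc]
        have e1 : Q n = 1 + PowerSeries.X ^ (n + 1) * ((c : ℤ⟦X⟧) + PowerSeries.X * r') := by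
          rw [← hr']; linear_combination hr
        have e2 : ((oneSubXPow n.succPNat ^ c : ℤ⟦X⟧ˣ) : ℤ⟦X⟧) =
            1 - (c : ℤ⟦X⟧) * PowerSeries.X ^ (n + 1) + PowerSeries.X ^ (n + 1 + 1) * t := by
          linear_combination ht
        rw [e1, e2]
        refine ⟨r' + t - (c : ℤ⟦X⟧) * PowerSeries.X ^ n * ((c : ℤ⟦X⟧) + PowerSeries.X * r') +
          PowerSeries.X ^ (n + 1) * ((c : ℤ⟦X⟧) + PowerSeries.X * r') * t, ?_⟩
        ring
    refine ⟨fun j => - PowerSeries.coeff (j : ℕ) (Q j.natPred), fun n => ?_⟩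
    have hprod : ∀ n, semigroupPolynomial S = Q n * ∏ k ∈ Finset.range n,
        ((oneSubXPow k.succPNat ^
          (- PowerSeries.coeff (k.succPNat : ℕ) (Q k.succPNat.natPred)) : ℤ⟦X⟧ˣ) : ℤ⟦X⟧) := by
      intro n
      induction n with
      | zero => simp [Q]
      | succ n ih =>
        rw [Finset.prod_range_succ, hQ, ih]
        simp only [Nat.natPred_succPNat, Nat.succPNat_coe, Nat.succ_eq_add_one]
        set u := oneSubXPow n.succPNat ^ (PowerSeries.coeff (n + 1) (Q n)) with hu
        have h1 : oneSubXPow n.succPNat ^ (-(PowerSeries.coeff (n + 1) (Q n))) = u⁻¹ := by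
          rw [hu, zpow_neg]
        rw [h1]
        have := u.mul_inv
        linear_combination (-(Q n * ∏ k ∈ Finset.range n, ((oneSubXPow k.succPNat ^
          (- PowerSeries.coeff (k + 1) (Q k)) : ℤ⟦X⟧ˣ) : ℤ⟦X⟧))) * this
    nth_rewrite 1 [hprod n]
    rw [← sub_one_mul]
    exact (hQ1 n).mul_right _
  · intro e f he hf
    have : ∀ m : ℕ, e m.succPNat = f m.succPNat := by
      intro m
      induction m using Nat.strong_induction_on with
      | _ m ih =>
        have h1 := dvd_sub (he (m + 1)) (hf (m + 1))
        rw [Finset.prod_range_succ, Finset.prod_range_succ] at h1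
        have hA : ∏ k ∈ Finset.range m,
            ((oneSubXPow k.succPNat ^ e k.succPNat : ℤ⟦X⟧ˣ) : ℤ⟦X⟧) =
            ∏ k ∈ Finset.range m,
              ((oneSubXPow k.succPNat ^ f k.succPNat : ℤ⟦X⟧ˣ) : ℤ⟦X⟧) :=
          Finset.prod_congr rfl fun k hk => by rw [ih k (Finset.mem_range.mp hk)]
        rw [hA, sub_sub_sub_cancel_left, ← mul_sub, ← Units.coe_prod, Units.dvd_mul_left] at h1
        have h2 := oneSubXPow_zpow m.succPNat (e m.succPNat)
        have h3 := oneSubXPow_zpow m.succPNat (f m.succPNat)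
        simp only [Nat.succPNat_coe, Nat.succ_eq_add_one] at h2 h3
        have h4 := dvd_add (dvd_sub h2 h3) h1
        have h5 : PowerSeries.X ^ (m + 1 + 1) ∣
            PowerSeries.C (e m.succPNat - f m.succPNat) * (PowerSeries.X ^ (m + 1) : ℤ⟦X⟧) := by
          convert h4 using 1
          simp only [map_sub, eq_intCast]
          ring
        have h6 := PowerSeries.X_pow_dvd_iff.mp h5 (m + 1) (by omega)
        rw [PowerSeries.coeff_C_mul, PowerSeries.coeff_X_pow] at h6
        simp only [if_true, mul_one] at h6
        omega
    funext j
    have := this j.natPred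
    rwa [PNat.succPNat_natPred] at this

/-- The cyclotomic exponent sequence `(e_j)_{j ≥ 1}` of `S`. -/
noncomputable def cyclotomicExponent (S : AddSubmonoid ℕ) : ℕ+ → ℤ :=
  (existsUnique_cyclotomicExponentSequence S).choose

theorem cyclotomicExponent_spec (S : AddSubmonoid ℕ) :
    IsCyclotomicExponentSequence S (cyclotomicExponent S) :=
  (existsUnique_cyclotomicExponentSequence S).choose_spec.1

/-- The set `E(S)` of all `d ≥ 2` with `e_d ≠ 0` that are not minimal generators of `S`. -/
def exponentSet (S : AddSubmonoid ℕ) : Set ℕ :=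
  {d | 2 ≤ d ∧ (∃ j : ℕ+, (j : ℕ) = d ∧ cyclotomicExponent S j ≠ 0) ∧ d ∉ minimalGenerators S}

end NumSgp

/-! Everything reduces to one local criterion, `mem_exponentSet_iff`: if the Betti elements below
`s` for `≤_S` form a chain, and `s ≥ 2` in `S` is not a minimal generator, then `s` is a Betti
element iff `e_s ≠ 0`.

Two facts give it. (1) For a series supported on `S` with constant term 1, the exponent at `s` of
its expansion into powers of `1 - x^j` depends only on the coefficients at elements `t ≤_S s`
(`exponent_congr`, by logarithmic derivatives). (2) Under the chain hypothesis there is a finite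
family `V` of nonzero factorizations with pairwise disjoint supports such that every `t ≤_S s` in
`S` has exactly one factorization lying above no member of `V` (`exists_avoiding_family`). Disjoint
supports make the generating function of the avoiding vectors equal to `∏_{v ∈ V} (1 - x^{|v|}) /
∏_i (1 - x^{n_i})`, where `|v|` is the weight and the `n_i` are the minimal generators
(`avoidingSeries_eq_prod`). It agrees with the Hilbert series below `s`, so `e_s` counts the members
of `V` of weight `s`, and there are some exactly when `s` is a Betti element.

For (2), `V` picks one vector from each R-class of each Betti element `b` below `s`, except one
distinguished class with representative `w₀ b`. Replacing `v ∈ V` by `w₀ |v|` is a terminating and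
confluent rewriting whose normal forms are the avoiding vectors.

If `S` is Betti-sorted the criterion applies at every `s`; if `E(S)` is a chain, strong induction
places every Betti element in it. Divisibility chains and singletons are special chains. -/

namespace NumSgp

/-! ### Logarithmic derivatives of power series. -/

/-- `L` is the logarithmic derivative of `F` with respect to `X d/dX`. -/
def IsLogDeriv (F L : ℤ⟦X⟧) : Prop := PowerSeries.X * PowerSeries.derivative ℤ F = F * L

theorem IsLogDeriv.one : IsLogDeriv 1 0 := by
  simp [IsLogDeriv]

theorem IsLogDeriv.mul {F G L M : ℤ⟦X⟧} (hF : IsLogDeriv F L) (hG : IsLogDeriv G M) :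
    IsLogDeriv (F * G) (L + M) := by
  unfold IsLogDeriv at *
  rw [Derivation.leibniz, smul_eq_mul, smul_eq_mul]
  linear_combination G * hF + F * hG

theorem IsLogDeriv.of_mul {F G L M : ℤ⟦X⟧} (hF0 : F ≠ 0) (hF : IsLogDeriv F L)
    (hFG : IsLogDeriv (F * G) M) : IsLogDeriv G (M - L) := by
  unfold IsLogDeriv at *
  rw [Derivation.leibniz, smul_eq_mul, smul_eq_mul] at hFG
  apply mul_left_cancel₀ hF0
  linear_combination hFG - G * hF

theorem IsLogDeriv.prod {ι : Type*} (s : Finset ι) (F L : ι → ℤ⟦X⟧)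
    (h : ∀ i ∈ s, IsLogDeriv (F i) (L i)) : IsLogDeriv (∏ i ∈ s, F i) (∑ i ∈ s, L i) := by
  classical
  induction s using Finset.induction_on with
  | empty => simpa using IsLogDeriv.one
  | insert a s ha ih =>
    rw [Finset.prod_insert ha, Finset.sum_insert ha]
    exact (h a (Finset.mem_insert_self a s)).mul
      (ih fun i hi => h i (Finset.mem_insert_of_mem hi))

theorem IsLogDeriv.units_inv {u : ℤ⟦X⟧ˣ} {L : ℤ⟦X⟧} (h : IsLogDeriv u L) :
    IsLogDeriv (u⁻¹ : ℤ⟦X⟧ˣ) (-L) := by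
  have := IsLogDeriv.of_mul (G := (u⁻¹ : ℤ⟦X⟧ˣ)) (M := 0) u.ne_zero h
    (by rw [Units.mul_inv]; exact IsLogDeriv.one)
  simpa using this

theorem IsLogDeriv.units_zpow {u : ℤ⟦X⟧ˣ} {L : ℤ⟦X⟧} (h : IsLogDeriv u L) (e : ℤ) :
    IsLogDeriv (u ^ e : ℤ⟦X⟧ˣ) (e • L) := by
  induction e using Int.induction_on with
  | zero => simpa using IsLogDeriv.one
  | succ i ih =>
    rw [zpow_add_one, Units.val_mul, add_smul, one_smul]
    exact ih.mul h
  | pred i ih =>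
    rw [zpow_sub_one, Units.val_mul, sub_smul, one_smul, sub_eq_add_neg]
    exact ih.mul h.units_inv

/-- The logarithmic derivative of `1 - X ^ j`. -/
noncomputable def logDerivOneSub (j : ℕ) : ℤ⟦X⟧ :=
  PowerSeries.mk fun n => if j ∣ n ∧ n ≠ 0 then -(j : ℤ) else 0

theorem isLogDeriv_one_sub_X_pow {j : ℕ} (hj : j ≠ 0) :
    IsLogDeriv (1 - PowerSeries.X ^ j) (logDerivOneSub j) := by
  unfold IsLogDeriv
  have h1 : PowerSeries.X * PowerSeries.derivative ℤ (1 - PowerSeries.X ^ j : ℤ⟦X⟧) =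
      -(PowerSeries.C (j : ℤ) * PowerSeries.X ^ j) := by
    obtain ⟨k, rfl⟩ := Nat.exists_eq_succ_of_ne_zero hj
    rw [map_sub, Derivation.leibniz_pow]
    simp [PowerSeries.derivative_X, pow_succ]
    ring
  rw [h1]
  ext n
  rw [sub_mul, one_mul, map_neg, map_sub, PowerSeries.coeff_C_mul, PowerSeries.coeff_X_pow,
    PowerSeries.coeff_X_pow_mul', logDerivOneSub, PowerSeries.coeff_mk]
  rcases lt_trichotomy n j with h | rfl | h
  · have : ¬ (j ∣ n ∧ n ≠ 0) := fun h' => by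
      have := Nat.le_of_dvd (Nat.pos_of_ne_zero h'.2) h'.1
      omega
    simp [this, h.ne, h]
  · simp [hj]
  · have h2 : j ∣ n - j ↔ j ∣ n := (Nat.dvd_sub_self_right).trans (by simp [h.not_ge])
    have h3 : n ≠ 0 := by omega
    have h4 : n - j ≠ 0 := by omega
    simp [h.le, h.ne', PowerSeries.coeff_mk, h2, h3, h4]

theorem coeff_X_mul_derivative (F : ℤ⟦X⟧) (n : ℕ) :
    PowerSeries.coeff n (PowerSeries.X * PowerSeries.derivative ℤ F) =
      n * PowerSeries.coeff n F := by
  cases n with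
  | zero => simp
  | succ n =>
    rw [PowerSeries.coeff_succ_X_mul, PowerSeries.coeff_derivative]
    push_cast
    ring

/-- The negative logarithmic derivative of `∏ (1 - X ^ d) ^ (a d)`, coefficientwise. -/
def divisorSum (a : ℕ → ℤ) (n : ℕ) : ℤ := ∑ d ∈ n.divisors, d * a d

/-- When `F` has constant term 1, this recursion determines `divisorSum a n` from the coefficients
of `F` and the earlier divisor sums. -/
theorem IsLogDeriv.coeff_eq {F : ℤ⟦X⟧} {a : ℕ → ℤ}
    (h : IsLogDeriv F (PowerSeries.mk fun n => -divisorSum a n)) (n : ℕ) :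
    n * PowerSeries.coeff n F =
      -∑ p ∈ Finset.HasAntidiagonal.antidiagonal n, PowerSeries.coeff p.1 F * divisorSum a p.2 := by
  rw [← coeff_X_mul_derivative, h, PowerSeries.coeff_mul, ← Finset.sum_neg_distrib]
  simp

/-! ### Locality of the exponents with respect to `≤_S`. -/

section Local

variable {S : AddSubmonoid ℕ} {F F' : ℤ⟦X⟧} {a a' : ℕ → ℤ}

/-- If `i + j = n` is a gap, then `i` or `j` is a gap, so by induction only the term with `i = 0`
survives in the recursion. -/
theorem divisorSum_eq_zero (hF0 : PowerSeries.coeff 0 F = 1)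
    (hFS : ∀ n ∉ S, PowerSeries.coeff n F = 0)
    (h : IsLogDeriv F (PowerSeries.mk fun n => -divisorSum a n)) (n : ℕ) (hn : n ∉ S) :
    divisorSum a n = 0 := by
  induction n using Nat.strong_induction_on with
  | _ n ih =>
    have h1 := h.coeff_eq n
    rw [hFS n hn, Finset.sum_eq_single (0, n), hF0] at h1
    · linarith
    · rintro ⟨i, j⟩ hp hne
      rw [Finset.HasAntidiagonal.mem_antidiagonal] at hp
      dsimp only at hp ⊢
      by_cases hi : i ∈ S
      · have hj : j ∉ S := fun hj => hn (hp ▸ add_mem hi hj)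
        have hi0 : i ≠ 0 := by rintro rfl; exact hne (by simp_all)
        rw [ih j (by omega) hj, mul_zero]
      · rw [hFS i hi, zero_mul]
    · simp

/-- At a gap `n` the divisor sum vanishes. A proper divisor with nonzero exponent would lie in `S`
by induction, and so would its multiple `n`; hence only `n * a n` remains. -/
theorem mem_of_exponent_ne_zero (hF0 : PowerSeries.coeff 0 F = 1)
    (hFS : ∀ n ∉ S, PowerSeries.coeff n F = 0)
    (h : IsLogDeriv F (PowerSeries.mk fun n => -divisorSum a n)) (n : ℕ) (hn0 : n ≠ 0)
    (ha : a n ≠ 0) : n ∈ S := by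
  induction n using Nat.strong_induction_on with
  | _ n ih =>
    by_contra hn
    have h1 := divisorSum_eq_zero hF0 hFS h n hn
    rw [divisorSum, Finset.sum_eq_single n] at h1
    · simp_all
    · intro d hd hdn
      rw [Nat.mem_divisors] at hd
      by_contra h2
      have hd0 : d ≠ 0 := by rintro rfl; simp at h2
      have hdS := ih d (lt_of_le_of_ne (Nat.le_of_dvd (by omega) hd.1) hdn) hd0
        (by intro h3; simp [h3] at h2)
      obtain ⟨k, rfl⟩ := hd.1
      exact hn (by simpa [mul_comm] using nsmul_mem hdS k)
    · simp [hn0]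

theorem sLE_trans {x y z : ℕ} (h : sLE S x y) (h' : sLE S y z) : sLE S x z := by
  obtain ⟨u, hu, rfl⟩ := h
  obtain ⟨v, hv, rfl⟩ := h'
  exact ⟨u + v, add_mem hu hv, by ring⟩

/-- In the recursion at `n ≤_S s`, a term `i + j = n` with both parts in `S` has both parts below
`s`; the other terms vanish. -/
theorem divisorSum_congr {s : ℕ} (hF0 : PowerSeries.coeff 0 F = 1)
    (hF0' : PowerSeries.coeff 0 F' = 1)
    (hFS : ∀ n ∉ S, PowerSeries.coeff n F = 0) (hFS' : ∀ n ∉ S, PowerSeries.coeff n F' = 0)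
    (h : IsLogDeriv F (PowerSeries.mk fun n => -divisorSum a n))
    (h' : IsLogDeriv F' (PowerSeries.mk fun n => -divisorSum a' n))
    (heq : ∀ t ∈ S, sLE S t s → PowerSeries.coeff t F = PowerSeries.coeff t F')
    (n : ℕ) (hn : n ∈ S) (hns : sLE S n s) : divisorSum a n = divisorSum a' n := by
  induction n using Nat.strong_induction_on with
  | _ n ih =>
    have h1 := h.coeff_eq n
    have h2 := h'.coeff_eq n
    rw [heq n hn hns, h2, neg_inj, ← sub_eq_zero, ← Finset.sum_sub_distrib,
      Finset.sum_eq_single (0, n), hF0, hF0'] at h1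
    · linarith
    · rintro ⟨i, j⟩ hp hne
      rw [Finset.HasAntidiagonal.mem_antidiagonal] at hp
      dsimp only at hp ⊢
      by_cases hi : i ∈ S
      · by_cases hj : j ∈ S
        · have hi0 : i ≠ 0 := by rintro rfl; exact hne (by simp_all)
          rw [ih j (by omega) hj (sLE_trans ⟨i, hi, by omega⟩ hns),
            heq i hi (sLE_trans ⟨j, hj, hp⟩ hns), sub_self]
        · rw [divisorSum_eq_zero hF0 hFS h j hj, divisorSum_eq_zero hF0' hFS' h' j hj]
          simp
      · rw [hFS i hi, hFS' i hi]
        simp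
    · simp

/-- The exponent at `n` of a product expansion only depends on the coefficients
at the elements below `n`. -/
theorem exponent_congr {s : ℕ} (hF0 : PowerSeries.coeff 0 F = 1)
    (hF0' : PowerSeries.coeff 0 F' = 1)
    (hFS : ∀ n ∉ S, PowerSeries.coeff n F = 0) (hFS' : ∀ n ∉ S, PowerSeries.coeff n F' = 0)
    (h : IsLogDeriv F (PowerSeries.mk fun n => -divisorSum a n))
    (h' : IsLogDeriv F' (PowerSeries.mk fun n => -divisorSum a' n))
    (heq : ∀ t ∈ S, sLE S t s → PowerSeries.coeff t F = PowerSeries.coeff t F')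
    (n : ℕ) (hn0 : n ≠ 0) (hn : n ∈ S) (hns : sLE S n s) : a n = a' n := by
  induction n using Nat.strong_induction_on with
  | _ n ih =>
    have h1 := divisorSum_congr hF0 hF0' hFS hFS' h h' heq n hn hns
    rw [divisorSum, divisorSum, ← sub_eq_zero, ← Finset.sum_sub_distrib,
      Finset.sum_eq_single n, ← mul_sub] at h1
    · have : (n : ℤ) ≠ 0 := by exact_mod_cast hn0
      have := (mul_eq_zero.mp h1).resolve_left this
      linarith
    · intro d hd hdn
      rw [Nat.mem_divisors] at hd
      have hd0 : d ≠ 0 := by rintro rfl; simp_all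
      by_cases hdS : d ∈ S
      · obtain ⟨k, rfl⟩ := hd.1
        have hk : k ≠ 0 := by rintro rfl; simp at hn0
        rw [ih d (lt_of_le_of_ne (Nat.le_of_dvd (by omega) hd.1) hdn) hd0 hdS, sub_self]
        -- A divisor of `n` lying in `S` is also below `n` for `≤_S`, since the difference is a
        -- multiple of it.
        refine sLE_trans ⟨(k - 1) * d, by simpa using nsmul_mem hdS (k - 1), ?_⟩ hns
        obtain ⟨k, rfl⟩ := Nat.exists_eq_succ_of_ne_zero hk
        simp only [Nat.succ_eq_add_one, Nat.add_sub_cancel]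
        ring
      · have e1 : a d = 0 := by
          by_contra h3; exact hdS (mem_of_exponent_ne_zero hF0 hFS h d hd0 h3)
        have e2 : a' d = 0 := by
          by_contra h3; exact hdS (mem_of_exponent_ne_zero hF0' hFS' h' d hd0 h3)
        rw [e1, e2, sub_self]
    · simp [hn0]

end Local

/-! ### Product expansion of the Hilbert series. -/

/-- The exponents of the Hilbert series, that is, of `P_S / (1 - x)`. -/
noncomputable def hilbertExponent (S : AddSubmonoid ℕ) (n : ℕ) : ℤ :=
  (if h : 0 < n then cyclotomicExponent S ⟨n, h⟩ else 0) - if n = 1 then 1 else 0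

theorem isLogDeriv_oneSubXPow (j : ℕ+) : IsLogDeriv (oneSubXPow j) (logDerivOneSub j) :=
  isLogDeriv_one_sub_X_pow j.ne_zero

theorem sum_coeff_logDerivOneSub (e : ℕ+ → ℤ) {n j : ℕ} (hj : j ≤ n) :
    ∑ k ∈ Finset.range n, e k.succPNat * PowerSeries.coeff j (logDerivOneSub (k + 1)) =
      -divisorSum (fun n => if h : 0 < n then e ⟨n, h⟩ else 0) j := by
  rcases Nat.eq_zero_or_pos j with rfl | hj0
  · simp [logDerivOneSub, divisorSum]
  have hdiv : j.divisors = ((Finset.range n).image Nat.succ).filter (· ∣ j) := by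
    ext d
    simp only [Nat.mem_divisors, Finset.mem_filter, Finset.mem_image, Finset.mem_range]
    constructor
    · rintro ⟨hd, -⟩
      have h0 : 0 < d := Nat.pos_of_dvd_of_pos hd hj0
      have := Nat.le_of_dvd hj0 hd
      exact ⟨⟨d - 1, by omega, by omega⟩, hd⟩
    · exact fun h => ⟨h.2, hj0.ne'⟩
  rw [divisorSum, hdiv, Finset.sum_filter, Finset.sum_image (fun x _ y _ h => Nat.succ_injective h),
    ← Finset.sum_neg_distrib]
  refine Finset.sum_congr rfl fun k _ => ?_
  rw [logDerivOneSub, PowerSeries.coeff_mk]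
  by_cases hk : k + 1 ∣ j
  · have : k.succPNat = ⟨k + 1, Nat.succ_pos k⟩ := rfl
    simp only [Nat.succ_eq_add_one, hk, this]
    simp [hj0.ne']
    ring
  · simp [hk]

/-- The product of the first `n` factors agrees with the series up to degree `n`, which suffices to
compare coefficients at `n`; the infinite product never has to be differentiated. -/
theorem isLogDeriv_semigroupPolynomial (S : AddSubmonoid ℕ) :
    IsLogDeriv (semigroupPolynomial S) (PowerSeries.mk fun n => -divisorSum
      (fun n => if h : 0 < n then cyclotomicExponent S ⟨n, h⟩ else 0) n) := by
  have hspec := (isCyclotomicExponentSequence_iff S _).mp (cyclotomicExponent_spec S)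
  generalize cyclotomicExponent S = e at *
  generalize semigroupPolynomial S = P at *
  unfold IsLogDeriv
  ext n
  have hQL : IsLogDeriv
      (∏ k ∈ Finset.range n, ((oneSubXPow k.succPNat ^ e k.succPNat : ℤ⟦X⟧ˣ) : ℤ⟦X⟧))
      (∑ k ∈ Finset.range n, e k.succPNat • logDerivOneSub (k + 1)) :=
    IsLogDeriv.prod _ _ _ fun k _ => (isLogDeriv_oneSubXPow k.succPNat).units_zpow _
  have hPQ := hspec n
  generalize (∏ k ∈ Finset.range n, ((oneSubXPow k.succPNat ^ e k.succPNat : ℤ⟦X⟧ˣ) : ℤ⟦X⟧)) = Q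
    at hQL hPQ
  replace hPQ : ∀ i ≤ n, PowerSeries.coeff i P = PowerSeries.coeff i Q := fun i hi => by
    have := PowerSeries.X_pow_dvd_iff.mp hPQ i (by omega)
    rwa [map_sub, sub_eq_zero] at this
  have h1 := congrArg (PowerSeries.coeff n) hQL
  rw [coeff_X_mul_derivative, PowerSeries.coeff_mul] at h1
  rw [coeff_X_mul_derivative, PowerSeries.coeff_mul, hPQ n le_rfl, h1]
  refine Finset.sum_congr rfl ?_
  rintro ⟨i, j⟩ hij
  rw [Finset.HasAntidiagonal.mem_antidiagonal] at hij
  dsimp only at hij ⊢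
  rw [hPQ i (by omega), PowerSeries.coeff_mk, map_sum, ← sum_coeff_logDerivOneSub e (n := n)
    (by omega)]
  simp only [map_zsmul, smul_eq_mul]

theorem isLogDeriv_hilbertSeries (S : AddSubmonoid ℕ) :
    IsLogDeriv (hilbertSeries S)
      (PowerSeries.mk fun n => -divisorSum (hilbertExponent S) n) := by
  have h2 := IsLogDeriv.of_mul (isUnit_one_sub_X_pow 1).ne_zero
    (isLogDeriv_one_sub_X_pow one_ne_zero)
    (by simpa [semigroupPolynomial] using isLogDeriv_semigroupPolynomial S)
  convert h2 using 1
  ext n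
  simp only [map_sub, PowerSeries.coeff_mk, logDerivOneSub, divisorSum, hilbertExponent, mul_sub,
    Finset.sum_sub_distrib]
  rcases eq_or_ne n 0 with rfl | hn
  · simp
  · simp [hn]
    ring

/-! ### Generating functions of vectors avoiding a family with disjoint supports. -/

section Avoiding

variable {ι : Type*}

/-- `z` is not above any element of `V`. -/
def Avoids (V : Finset (ι →₀ ℕ)) (z : ι →₀ ℕ) : Prop := ∀ v ∈ V, ¬ v ≤ z

/-- Disjointness of supports. -/
def SuppDisjoint (u v : ι →₀ ℕ) : Prop := ∀ i, u i = 0 ∨ v i = 0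

theorem SuppDisjoint.le_add_iff {u v y : ι →₀ ℕ} (h : SuppDisjoint u v) : u ≤ y + v ↔ u ≤ y := by
  refine ⟨fun h' i => ?_, fun h' i => (h' i).trans (by simp)⟩
  have := h' i
  rcases h i with h0 | h0
  · simp [h0]
  · simpa [h0] using this

/-- The generating function of the vectors avoiding `V`. -/
noncomputable def avoidingSeries (d : ι → ℕ) (V : Finset (ι →₀ ℕ)) : ℤ⟦X⟧ :=
  PowerSeries.mk fun t => ({z : ι →₀ ℕ | Finsupp.weight d z = t ∧ Avoids V z}.ncard : ℤ)

variable {d : ι → ℕ} [Finite ι]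

/-- The vectors lost by also avoiding `v` are the `y + v` with `y` avoiding `V`: as `v` is disjoint
from each `u ∈ V`, adding it does not affect `u ≤ y`. -/
theorem avoidingSeries_insert [DecidableEq ι] (hd : ∀ i, d i ≠ 0) {V : Finset (ι →₀ ℕ)}
    {v : ι →₀ ℕ} (hv : ∀ u ∈ V, SuppDisjoint u v) :
    avoidingSeries d (insert v V) =
      (1 - PowerSeries.X ^ Finsupp.weight d v) * avoidingSeries d V := by
  ext t
  have hfin := Finsupp.finite_of_nat_weight_eq d hd
  rw [sub_mul, one_mul, map_sub, PowerSeries.coeff_X_pow_mul']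
  simp only [avoidingSeries, PowerSeries.coeff_mk]
  set A := {z : ι →₀ ℕ | Finsupp.weight d z = t ∧ Avoids V z}
  set B := {z : ι →₀ ℕ | Finsupp.weight d z = t ∧ Avoids (insert v V) z}
  set C := {z : ι →₀ ℕ | (Finsupp.weight d z = t ∧ Avoids V z) ∧ v ≤ z}
  have hAfin : A.Finite := (hfin t).subset fun z hz => hz.1
  have hABC : A = B ∪ C := by
    ext z
    simp only [A, B, C, Avoids, Set.mem_union, Set.mem_ofPred_eq, Finset.mem_insert,
      forall_eq_or_imp]
    tauto
  have hdisj : Disjoint B C := by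
    rw [Set.disjoint_left]
    exact fun z hz hz' => hz.2 v (Finset.mem_insert_self _ _) hz'.2
  have hcard : A.ncard = B.ncard + C.ncard := by
    rw [hABC, Set.ncard_union_eq hdisj (hAfin.subset (hABC ▸ Set.subset_union_left))
      (hAfin.subset (hABC ▸ Set.subset_union_right))]
  have hC : (C.ncard : ℤ) = if Finsupp.weight d v ≤ t then
      ({z : ι →₀ ℕ | Finsupp.weight d z = t - Finsupp.weight d v ∧ Avoids V z}.ncard : ℤ)
      else 0 := by
    split_ifs with h
    · have : C = (fun y => y + v) '' {z : ι →₀ ℕ |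
          Finsupp.weight d z = t - Finsupp.weight d v ∧ Avoids V z} := by
        ext z
        simp only [C, Set.mem_image, Set.mem_ofPred_eq]
        constructor
        · rintro ⟨⟨h1, h2⟩, h3⟩
          have hz : z - v + v = z := tsub_add_cancel_of_le h3
          have hw := congrArg (Finsupp.weight d) hz
          rw [map_add] at hw
          exact ⟨z - v, ⟨by omega, fun u hu hle => h2 u hu (hle.trans tsub_le_self)⟩, hz⟩
        · rintro ⟨y, ⟨h1, h2⟩, rfl⟩
          refine ⟨⟨by rw [map_add]; omega, fun u hu => ?_⟩, le_add_self⟩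
          rw [(hv u hu).le_add_iff]
          exact h2 u hu
      rw [this, Set.ncard_image_of_injective _ (add_left_injective v)]
    · have : C = ∅ := by
        ext z
        simp only [C, Set.mem_ofPred_eq, Set.mem_empty_iff_false, iff_false]
        rintro ⟨⟨h1, -⟩, h3⟩
        have hw := congrArg (Finsupp.weight d) (tsub_add_cancel_of_le h3)
        rw [map_add] at hw
        omega
      simp [this]
  rw [← hC, hcard]
  push_cast
  ring

theorem avoidingSeries_eq_prod (hd : ∀ i, d i ≠ 0) (V : Finset (ι →₀ ℕ))
    (hV : ∀ u ∈ V, ∀ v ∈ V, u ≠ v → SuppDisjoint u v) :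
    avoidingSeries d V =
      (∏ v ∈ V, (1 - PowerSeries.X ^ Finsupp.weight d v)) * avoidingSeries d ∅ := by
  classical
  induction V using Finset.induction_on with
  | empty => simp
  | insert a s ha ih =>
    rw [avoidingSeries_insert hd, Finset.prod_insert ha, ih, mul_assoc]
    · exact fun u hu v hv =>
        hV u (Finset.mem_insert_of_mem hu) v (Finset.mem_insert_of_mem hv)
    · exact fun u hu => hV u (Finset.mem_insert_of_mem hu) a (Finset.mem_insert_self _ _)
        (by rintro rfl; exact ha hu)

/-- Apply the product formula to the unit vectors, which only `0` avoids. -/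
theorem prod_mul_avoidingSeries_empty [Fintype ι] (hd : ∀ i, d i ≠ 0) :
    (∏ i, (1 - PowerSeries.X ^ d i)) * avoidingSeries d ∅ = 1 := by
  classical
  have hinj : Function.Injective fun i : ι => Finsupp.single i 1 :=
    Finsupp.single_left_injective one_ne_zero
  have h := avoidingSeries_eq_prod hd (Finset.univ.image fun i : ι => Finsupp.single i 1) (by
    simp only [Finset.mem_image, Finset.mem_univ, true_and]
    rintro _ ⟨i, rfl⟩ _ ⟨j, rfl⟩ hij k
    have : i ≠ j := by rintro rfl; exact hij rfl
    simp only [Finsupp.single_apply]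
    split_ifs <;> simp_all)
  rw [Finset.prod_image fun x _ y _ h => hinj h] at h
  simp only [Finsupp.weight_single, one_smul] at h
  rw [← h]
  have hz : ∀ z : ι →₀ ℕ, Avoids (Finset.univ.image fun i : ι => Finsupp.single i 1) z ↔ z = 0 := by
    intro z
    simp only [Avoids, Finset.mem_image, Finset.mem_univ, true_and, forall_exists_index,
      forall_apply_eq_imp_iff, Finsupp.single_le_iff]
    rw [Finsupp.ext_iff]
    exact forall_congr' fun i => by simp
  ext t
  simp only [avoidingSeries, hz, PowerSeries.coeff_mk, PowerSeries.coeff_one]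
  split_ifs with ht
  · have : {z : ι →₀ ℕ | Finsupp.weight d z = t ∧ z = 0} = {0} := by
      ext z; simp only [Set.mem_ofPred_eq, Set.mem_singleton_iff]
      exact ⟨fun h => h.2, fun h => ⟨by simp [h, ht], h⟩⟩
    simp [this]
  · have : {z : ι →₀ ℕ | Finsupp.weight d z = t ∧ z = 0} = ∅ := by
      ext z; simp only [Set.mem_ofPred_eq, Set.mem_empty_iff_false, iff_false]
      rintro ⟨h1, rfl⟩
      exact ht (by simpa using h1.symm)
    simp [this]

theorem isLogDeriv_avoidingSeries [Fintype ι] (hd : ∀ i, d i ≠ 0) (V : Finset (ι →₀ ℕ))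
    (hV0 : ∀ v ∈ V, v ≠ 0) (hV : ∀ u ∈ V, ∀ v ∈ V, u ≠ v → SuppDisjoint u v) :
    IsLogDeriv (avoidingSeries d V) (PowerSeries.mk fun n => -divisorSum
      (fun n => ((V.filter fun v => Finsupp.weight d v = n).card : ℤ) -
        (Finset.univ.filter fun i => d i = n).card) n) := by
  have hw : ∀ v ∈ V, Finsupp.weight d v ≠ 0 := fun v hv h => by
    obtain ⟨i, hi⟩ : ∃ i, v i ≠ 0 := by
      by_contra h'
      push Not at h'
      exact hV0 v hv (Finsupp.ext h')
    have := Finsupp.le_weight d (hd i) v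
    omega
  have h1 : IsLogDeriv (∏ v ∈ V, (1 - PowerSeries.X ^ Finsupp.weight d v))
      (∑ v ∈ V, logDerivOneSub (Finsupp.weight d v)) :=
    IsLogDeriv.prod _ _ _ fun v hv => isLogDeriv_one_sub_X_pow (hw v hv)
  have h2 : IsLogDeriv (∏ i, (1 - PowerSeries.X ^ d i)) (∑ i, logDerivOneSub (d i)) :=
    IsLogDeriv.prod _ _ _ fun i _ => isLogDeriv_one_sub_X_pow (hd i)
  have hprod := prod_mul_avoidingSeries_empty hd
  have h3 := h1.mul (IsLogDeriv.of_mul (left_ne_zero_of_mul_eq_one hprod) h2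
    (by rw [hprod]; exact IsLogDeriv.one))
  rw [← avoidingSeries_eq_prod hd V hV, zero_sub, ← sub_eq_add_neg] at h3
  have key : ∀ {κ : Type _} (s : Finset κ) (f : κ → ℕ) (n : ℕ),
      PowerSeries.coeff n (∑ k ∈ s, logDerivOneSub (f k)) =
        -∑ m ∈ n.divisors, (m : ℤ) * (s.filter fun k => f k = m).card := by
    intro κ s f n
    rw [map_sum, ← Finset.sum_neg_distrib]
    simp only [logDerivOneSub, PowerSeries.coeff_mk, Finset.card_filter, Nat.cast_sum,
      Nat.cast_ite, Nat.cast_one, Nat.cast_zero, Finset.mul_sum, mul_ite, mul_one, mul_zero]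
    simp only [← Finset.sum_neg_distrib]
    rw [Finset.sum_comm]
    refine Finset.sum_congr rfl fun k _ => ?_
    have : ∀ x : ℕ, -(if f k = x then (x : ℤ) else 0) = if f k = x then -(f k : ℤ) else 0 := by
      intro x
      split_ifs with h
      · rw [h]
      · simp
    simp only [this, Finset.sum_ite_eq, Nat.mem_divisors]
  convert h3 using 1
  ext n
  rw [map_sub, key, key, PowerSeries.coeff_mk]
  simp only [divisorSum, mul_sub, Finset.sum_sub_distrib]
  ring

end Avoiding

/-! ### Rewriting factorizations: confluence and termination. -/

section Rewriting

variable {ι : Type*}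

theorem SuppDisjoint.symm {u v : ι →₀ ℕ} (h : SuppDisjoint u v) : SuppDisjoint v u :=
  fun i => (h i).symm

/-- Replacement of an element `v` of `V` by the vector `w₀ (weight v)`. -/
def Step (d : ι → ℕ) (V : Finset (ι →₀ ℕ)) (w₀ : ℕ → ι →₀ ℕ) (x y : ι →₀ ℕ) : Prop :=
  ∃ v ∈ V, ∃ r, x = r + v ∧ y = r + w₀ (Finsupp.weight d v)

/-- Distinct vectors of the same weight with a common index in their supports. -/
def Share (d : ι → ℕ) (u v : ι →₀ ℕ) : Prop :=
  Finsupp.weight d u = Finsupp.weight d v ∧ ∃ i, u i ≠ 0 ∧ v i ≠ 0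

/-- The relation of lying in the same R-class. -/
def SameClass (d : ι → ℕ) : (ι →₀ ℕ) → (ι →₀ ℕ) → Prop := Relation.EqvGen (Share d)

variable {d : ι → ℕ} {V : Finset (ι →₀ ℕ)} {w₀ : ℕ → ι →₀ ℕ}

theorem SameClass.weight_eq {u v : ι →₀ ℕ} (h : SameClass d u v) :
    Finsupp.weight d u = Finsupp.weight d v := by
  induction h with
  | rel x y h => exact h.1
  | refl x => rfl
  | symm x y _ ih => exact ih.symm
  | trans x y z _ _ ih ih' => exact ih.trans ih'

theorem SameClass.symm {u v : ι →₀ ℕ} (h : SameClass d u v) : SameClass d v u :=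
  Relation.EqvGen.symm _ _ h

theorem SameClass.trans {u v w : ι →₀ ℕ} (h : SameClass d u v) (h' : SameClass d v w) :
    SameClass d u w :=
  Relation.EqvGen.trans _ _ _ h h'

theorem suppDisjoint_of_not_sameClass {u v : ι →₀ ℕ}
    (hw : Finsupp.weight d u = Finsupp.weight d v) (h : ¬ SameClass d u v) : SuppDisjoint u v := by
  intro i
  by_contra hi
  push Not at hi
  exact h (Relation.EqvGen.rel _ _ ⟨hw, i, hi⟩)

/-- Two different members of `V` below the same vector have disjoint supports, so their sum is also
below it and the two replacements commute. -/
theorem step_diamond (hdis : ∀ u ∈ V, ∀ v ∈ V, u ≠ v → SuppDisjoint u v) (a b c : ι →₀ ℕ)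
    (hab : Step d V w₀ a b) (hac : Step d V w₀ a c) :
    ∃ e, Relation.ReflGen (Step d V w₀) b e ∧ Relation.ReflTransGen (Step d V w₀) c e := by
  obtain ⟨v, hv, r, rfl, rfl⟩ := hab
  obtain ⟨v', hv', r', h, rfl⟩ := hac
  rcases eq_or_ne v v' with rfl | hne
  · obtain rfl : r = r' := add_right_cancel h
    exact ⟨_, .refl, .refl⟩
  · have hle : v' ≤ r := by
      rw [← ((hdis v hv v' hv' hne).symm).le_add_iff, h]
      exact le_add_self
    obtain ⟨q, rfl⟩ := exists_add_of_le hle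
    have hr' : r' = q + v := by
      apply add_right_cancel (b := v')
      rw [← h]
      abel
    subst hr'
    refine ⟨q + w₀ (Finsupp.weight d v) + w₀ (Finsupp.weight d v'), .single ?_, .single ?_⟩
    · exact ⟨v', hv', q + w₀ (Finsupp.weight d v), by abel, rfl⟩
    · exact ⟨v, hv, q + w₀ (Finsupp.weight d v'), by abel, by abel⟩

theorem join_add {x y : ι →₀ ℕ} (h : Relation.Join (Relation.ReflTransGen (Step d V w₀)) x y)
    (r : ι →₀ ℕ) :
    Relation.Join (Relation.ReflTransGen (Step d V w₀)) (x + r) (y + r) := by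
  have hstep : ∀ x y, Step d V w₀ x y → Step d V w₀ (x + r) (y + r) := by
    rintro _ _ ⟨v, hv, q, rfl, rfl⟩
    exact ⟨v, hv, q + r, by abel, by abel⟩
  obtain ⟨z, hx, hy⟩ := h
  exact ⟨z + r, Relation.ReflTransGen.lift (· + r) hstep _ _ hx,
    Relation.ReflTransGen.lift (· + r) hstep _ _ hy⟩

theorem weight_mem {S : AddSubmonoid ℕ} (hdS : ∀ i, d i ∈ S) (z : ι →₀ ℕ) :
    Finsupp.weight d z ∈ S := by
  rw [Finsupp.weight_apply]
  exact sum_mem fun i _ => nsmul_mem (hdS i) _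

/-- Induction on the weight. Vectors sharing an index become joinable after cancelling one unit
there, so R-classes are joinable; across classes, `hB` connects each vector to `w₀ t`, within its
class or through a member of `V`. -/
theorem join_of_weight_eq {S : AddSubmonoid ℕ} {s : ℕ} (hd : ∀ i, d i ≠ 0) (hdS : ∀ i, d i ∈ S)
    (hdis : ∀ u ∈ V, ∀ v ∈ V, u ≠ v → SuppDisjoint u v)
    (hB : ∀ z z', Finsupp.weight d z = Finsupp.weight d z' → sLE S (Finsupp.weight d z) s →
      ¬ SameClass d z z' → SameClass d z (w₀ (Finsupp.weight d z)) ∨ ∃ v ∈ V, SameClass d z v)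
    (t : ℕ) (ht : sLE S t s) (z z' : ι →₀ ℕ) (hz : Finsupp.weight d z = t)
    (hz' : Finsupp.weight d z' = t) :
    Relation.Join (Relation.ReflTransGen (Step d V w₀)) z z' := by
  have heqv := Relation.equivalence_join_reflTransGen (step_diamond (d := d) (w₀ := w₀) hdis)
  induction t using Nat.strong_induction_on generalizing z z' with
  | _ t ih =>
    have hclass : ∀ x y, SameClass d x y → Finsupp.weight d x = t →
        Relation.Join (Relation.ReflTransGen (Step d V w₀)) x y := by
      intro x y h
      induction h with
      | rel x y h =>
        intro hx
        obtain ⟨hxy, i, hxi, hyi⟩ := h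
        have ex : x - Finsupp.single i 1 + Finsupp.single i 1 = x :=
          tsub_add_cancel_of_le (by simpa [Finsupp.single_le_iff, Nat.one_le_iff_ne_zero] using hxi)
        have ey : y - Finsupp.single i 1 + Finsupp.single i 1 = y :=
          tsub_add_cancel_of_le (by simpa [Finsupp.single_le_iff, Nat.one_le_iff_ne_zero] using hyi)
        have wx := congrArg (Finsupp.weight d) ex
        have wy := congrArg (Finsupp.weight d) ey
        rw [map_add, Finsupp.weight_single, one_smul] at wx wy
        have := hd i
        rw [← ex, ← ey]
        exact join_add (ih (t - d i) (by omega)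
          (sLE_trans ⟨d i, hdS i, by omega⟩ ht) _ _ (by omega) (by omega)) _
      | refl x => exact fun _ => heqv.refl x
      | symm x y h ih => exact fun hx => heqv.symm (ih ((SameClass.weight_eq h).trans hx))
      | trans x y z h _ ih ih' =>
        exact fun hx => heqv.trans (ih hx) (ih' ((SameClass.weight_eq h).symm.trans hx))
    by_cases hzz : SameClass d z z'
    · exact hclass z z' hzz hz
    · have key : ∀ x x', Finsupp.weight d x = t → Finsupp.weight d x' = t → ¬ SameClass d x x' →
          Relation.Join (Relation.ReflTransGen (Step d V w₀)) x (w₀ t) := by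
        intro x x' hx hx' hxx
        rcases hB x x' (hx.trans hx'.symm) (hx ▸ ht) hxx with h | ⟨v, hv, h⟩
        · rw [hx] at h
          exact hclass _ _ h hx
        · refine heqv.trans (hclass _ _ h hx) ⟨w₀ t, .single ⟨v, hv, 0, by simp, ?_⟩, .refl⟩
          rw [← h.weight_eq, hx, zero_add]
      exact heqv.trans (key z z' hz hz' hzz)
        (heqv.symm (key z' z hz' hz fun h => hzz h.symm))

theorem Avoids.eq_of_reflTransGen {z z' : ι →₀ ℕ} (hz : Avoids V z)
    (h : Relation.ReflTransGen (Step d V w₀) z z') : z = z' := by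
  rcases h.cases_head with h | ⟨y, ⟨v, hv, r, rfl, -⟩, -⟩
  · exact h
  · exact absurd le_add_self (hz v hv)

theorem exists_avoids_weight_eq {W : ι → ℕ}
    (hw : ∀ v ∈ V, Finsupp.weight d (w₀ (Finsupp.weight d v)) = Finsupp.weight d v)
    (hW : ∀ v ∈ V, Finsupp.weight W (w₀ (Finsupp.weight d v)) < Finsupp.weight W v)
    (z : ι →₀ ℕ) : ∃ z', Finsupp.weight d z' = Finsupp.weight d z ∧ Avoids V z' := by
  induction h : Finsupp.weight W z using Nat.strong_induction_on generalizing z with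
  | _ n ih =>
    by_cases hz : Avoids V z
    · exact ⟨z, rfl, hz⟩
    · simp only [Avoids, not_forall, not_not] at hz
      obtain ⟨v, hv, hle⟩ := hz
      obtain ⟨r, rfl⟩ := exists_add_of_le hle
      obtain ⟨z', h1, h2⟩ := ih (Finsupp.weight W (w₀ (Finsupp.weight d v) + r)) (by
        rw [← h, map_add, map_add]
        have := hW v hv
        omega) _ rfl
      exact ⟨z', by rw [h1, map_add, map_add, hw v hv], h2⟩

/-- This is the termination measure. With `b` the weight of `v`, `w₀ b` only uses indices of level
below `b`, and its coefficients sum to at most `b < B`; its measure is therefore less than `B ^ b`,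
which a single index of `v` already reaches. -/
theorem exists_decreasing_weight [Fintype ι] (hd : ∀ i, d i ≠ 0)
    (hw : ∀ v ∈ V, Finsupp.weight d (w₀ (Finsupp.weight d v)) = Finsupp.weight d v)
    (hV0 : ∀ v ∈ V, v ≠ 0)
    (hw₀ : ∀ v ∈ V, ∀ u ∈ V, Finsupp.weight d v ≤ Finsupp.weight d u →
      SuppDisjoint (w₀ (Finsupp.weight d v)) u) :
    ∃ W : ι → ℕ, ∀ v ∈ V, Finsupp.weight W (w₀ (Finsupp.weight d v)) < Finsupp.weight W v := by
  set B := V.sup (Finsupp.weight d) + 2 with hBdef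
  -- The level of `i` is the largest weight of a member of `V` using `i`, and 0 if there is none.
  set lev : ι → ℕ := fun i => V.sup fun u => if u i = 0 then 0 else Finsupp.weight d u with hlev
  refine ⟨fun i => B ^ lev i, fun v hv => ?_⟩
  obtain ⟨i₀, hi₀⟩ : ∃ i, v i ≠ 0 := by
    by_contra h'
    push Not at h'
    exact hV0 v hv (Finsupp.ext h')
  set b := Finsupp.weight d v with hb
  have hbpos : 0 < b := by
    have h1 := Finsupp.le_weight_of_ne_zero' d hi₀
    have := hd i₀
    omega
  have hbB : b < B := by
    have : b ≤ V.sup (Finsupp.weight d) := Finset.le_sup (f := Finsupp.weight d) hv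
    omega
  have hlow : ∀ i, w₀ b i ≠ 0 → lev i ≤ b - 1 := by
    intro i hi
    refine Finset.sup_le fun u hu => ?_
    split_ifs with hui
    · exact Nat.zero_le _
    · by_contra hlt
      rcases hw₀ v hv u hu (by omega) i with h | h
      · exact hi h
      · exact hui h
  have hhigh : b ≤ lev i₀ := by
    have := Finset.le_sup (f := fun u : ι →₀ ℕ => if u i₀ = 0 then 0 else Finsupp.weight d u) hv
    simpa [hi₀, hlev] using this
  calc Finsupp.weight (fun i => B ^ lev i) (w₀ b)
      ≤ ∑ i, w₀ b i * d i * B ^ (b - 1) := by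
        rw [Finsupp.weight_eq_sum]
        refine Finset.sum_le_sum fun i _ => ?_
        by_cases hi : w₀ b i = 0
        · simp [hi]
        · rw [smul_eq_mul]
          refine Nat.mul_le_mul (Nat.le_mul_of_pos_right _ (Nat.pos_of_ne_zero (hd i))) ?_
          exact Nat.pow_le_pow_right (by omega) (hlow i hi)
    _ = b * B ^ (b - 1) := by
        rw [← Finset.sum_mul]
        congr 1
        have := hw v hv
        rw [Finsupp.weight_eq_sum] at this
        simpa using this
    _ < B * B ^ (b - 1) := Nat.mul_lt_mul_of_pos_right hbB (by positivity)
    _ = B ^ b := by rw [← pow_succ', Nat.sub_add_cancel hbpos]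
    _ ≤ B ^ lev i₀ := Nat.pow_le_pow_right (by omega) hhigh
    _ ≤ Finsupp.weight (fun i => B ^ lev i) v :=
        Finsupp.le_weight_of_ne_zero' (fun i => B ^ lev i) hi₀

end Rewriting

/-! ### R-classes and the construction of the family. -/

section Classes

variable {ι : Type*} {d : ι → ℕ} {S : AddSubmonoid ℕ}

/-- The elements having two factorizations in distinct R-classes. -/
def splitElements (d : ι → ℕ) : Set ℕ :=
  {b | ∃ z z', Finsupp.weight d z = b ∧ Finsupp.weight d z' = b ∧ ¬ SameClass d z z'}

theorem eq_zero_of_weight_eq_zero (hd : ∀ i, d i ≠ 0) {z : ι →₀ ℕ}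
    (h : Finsupp.weight d z = 0) : z = 0 := by
  ext i
  by_contra hi
  have h1 := Finsupp.le_weight_of_ne_zero' d hi
  have := hd i
  omega

theorem zero_notMem_splitElements (hd : ∀ i, d i ≠ 0) : 0 ∉ splitElements d := by
  rintro ⟨z, z', hz, hz', h⟩
  rw [eq_zero_of_weight_eq_zero hd hz, eq_zero_of_weight_eq_zero hd hz'] at h
  exact h (.refl _)

theorem exists_ne_zero_of_weight_ne_zero {z : ι →₀ ℕ} (h : Finsupp.weight d z ≠ 0) :
    ∃ i, z i ≠ 0 := by
  by_contra h'
  push Not at h'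
  exact h (by rw [Finsupp.ext (f := z) (g := 0) h', map_zero])

/-- With `σ` of weight `|u'| - |u|`, the vector `u + σ + ρ'` links the two sides: it shares an index
of `u` with the first and one of `ρ'` with the second. -/
theorem sameClass_add_of_sLE (hsurj : ∀ n ∈ S, ∃ z : ι →₀ ℕ, Finsupp.weight d z = n)
    {u ρ u' ρ' : ι →₀ ℕ} (hu : ∃ i, u i ≠ 0) (hρ' : ∃ i, ρ' i ≠ 0)
    (hle : sLE S (Finsupp.weight d u) (Finsupp.weight d u'))
    (hw : Finsupp.weight d (u + ρ) = Finsupp.weight d (u' + ρ')) :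
    SameClass d (u + ρ) (u' + ρ') := by
  obtain ⟨n, hn, hun⟩ := hle
  obtain ⟨σ, rfl⟩ := hsurj n hn
  obtain ⟨i, hi⟩ := hu
  obtain ⟨j, hj⟩ := hρ'
  rw [← map_add] at hun
  have hw' : Finsupp.weight d (u + σ + ρ') = Finsupp.weight d (u' + ρ') := by
    rw [map_add, hun, map_add]
  refine SameClass.trans (v := u + σ + ρ') (.rel _ _ ⟨hw.trans hw'.symm, i, ?_, ?_⟩)
    (.rel _ _ ⟨hw', j, ?_, ?_⟩) <;> simp only [Finsupp.add_apply] <;> omega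

/-- All factorizations of `b` that properly extend a vector with weight in `T` lie in a single
class, because any two such weights are comparable. If there are none, any factorization serves as
`w₀ b`. -/
theorem exists_distinguished (hsurj : ∀ n ∈ S, ∃ z : ι →₀ ℕ, Finsupp.weight d z = n) {T : Set ℕ}
    (hT : T ⊆ splitElements d) (hT0 : 0 ∉ T) (hchain : IsChain (sLE S) T) :
    ∃ w₀ : ℕ → ι →₀ ℕ, (∀ b ∈ T, Finsupp.weight d (w₀ b) = b) ∧
      ∀ b ∈ T, ∀ u ρ : ι →₀ ℕ, Finsupp.weight d u ∈ T → (∃ i, ρ i ≠ 0) → Finsupp.weight d (u + ρ) = b →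
        SameClass d (u + ρ) (w₀ b) := by
  have : ∀ b : ℕ, ∃ w : ι →₀ ℕ, b ∈ T → (Finsupp.weight d w = b ∧
      ∀ u ρ : ι →₀ ℕ, Finsupp.weight d u ∈ T → (∃ i, ρ i ≠ 0) → Finsupp.weight d (u + ρ) = b →
        SameClass d (u + ρ) w) := by
    intro b
    by_cases hex : ∃ u ρ : ι →₀ ℕ, Finsupp.weight d u ∈ T ∧ (∃ i, ρ i ≠ 0) ∧ Finsupp.weight d (u + ρ) = b
    · obtain ⟨u', ρ', hu', hρ', hb⟩ := hex
      refine ⟨u' + ρ', fun _ => ⟨hb, fun u ρ hu hρ hub => ?_⟩⟩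
      have hne : ∀ x : ι →₀ ℕ, Finsupp.weight d x ∈ T → ∃ i, x i ≠ 0 := fun x hx =>
        exists_ne_zero_of_weight_ne_zero (d := d) fun h => hT0 (h ▸ hx)
      rcases eq_or_ne (Finsupp.weight d u) (Finsupp.weight d u') with heq | hneq
      · exact sameClass_add_of_sLE hsurj (hne u hu) hρ' ⟨0, zero_mem _, heq⟩ (hub.trans hb.symm)
      · rcases hchain hu hu' hneq with h | h
        · exact sameClass_add_of_sLE hsurj (hne u hu) hρ' h (hub.trans hb.symm)
        · exact (sameClass_add_of_sLE hsurj (hne u' hu') hρ h (hb.trans hub.symm)).symm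
    · by_cases hb : b ∈ T
      · obtain ⟨z, -, hz, -⟩ := hT hb
        exact ⟨z, fun _ => ⟨hz, fun u ρ h1 h2 h3 => absurd ⟨u, ρ, h1, h2, h3⟩ hex⟩⟩
      · exact ⟨0, fun h => absurd h hb⟩
  choose w₀ hw₀ using this
  exact ⟨w₀, fun b hb => (hw₀ b hb).1, fun b hb => (hw₀ b hb).2⟩

/-- A representative of the R-class of `v`. -/
noncomputable def classRep (d : ι → ℕ) (v : ι →₀ ℕ) : ι →₀ ℕ :=
  (Quotient.mk (Relation.EqvGen.setoid (Share d)) v).out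

theorem sameClass_classRep (v : ι →₀ ℕ) : SameClass d (classRep d v) v :=
  Quotient.mk_out (s := Relation.EqvGen.setoid (Share d)) v

theorem SameClass.classRep_eq {u v : ι →₀ ℕ} (h : SameClass d u v) :
    classRep d u = classRep d v :=
  congrArg Quotient.out (Quotient.sound (s := Relation.EqvGen.setoid (Share d)) h)

/-- If the split elements below `s` form a chain, then there is a family of vectors with disjoint
supports such that every element below `s` has a unique factorization avoiding the family. -/
theorem exists_avoiding_family [Fintype ι] (hd : ∀ i, d i ≠ 0) (hdS : ∀ i, d i ∈ S)
    (hsurj : ∀ n ∈ S, ∃ z : ι →₀ ℕ, Finsupp.weight d z = n) (s : ℕ)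
    (hchain : IsChain (sLE S) {b | b ∈ splitElements d ∧ sLE S b s}) :
    ∃ V : Finset (ι →₀ ℕ), (∀ v ∈ V, v ≠ 0) ∧
      (∀ u ∈ V, ∀ v ∈ V, u ≠ v → SuppDisjoint u v) ∧
      (∀ t ∈ S, sLE S t s → {z | Finsupp.weight d z = t ∧ Avoids V z}.ncard = 1) ∧
      ((V.filter fun v => Finsupp.weight d v = s).Nonempty ↔ s ∈ splitElements d) := by
  set T := {b | b ∈ splitElements d ∧ sLE S b s} with hTdef
  have hT0 : 0 ∉ T := fun h => zero_notMem_splitElements hd h.1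
  obtain ⟨w₀, hw, hdist⟩ := exists_distinguished hsurj (fun b hb => hb.1) hT0 hchain
  -- One representative of each R-class of each `b ∈ T`, the class of `w₀ b` excepted.
  set V' : Set (ι →₀ ℕ) := {v | Finsupp.weight d v ∈ T ∧
    ¬ SameClass d v (w₀ (Finsupp.weight d v)) ∧ classRep d v = v} with hV'
  have hfin : V'.Finite := (Finsupp.finite_of_nat_weight_le d hd s).subset fun v hv => by
    obtain ⟨n, -, h⟩ := hv.1.2
    simp only [Set.mem_ofPred_eq]
    omega
  have hmem : ∀ v, v ∈ hfin.toFinset ↔ Finsupp.weight d v ∈ T ∧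
    ¬ SameClass d v (w₀ (Finsupp.weight d v)) ∧ classRep d v = v := fun v => by simp [hV']
  have hrep : ∀ x, Finsupp.weight d x ∈ T → ¬ SameClass d x (w₀ (Finsupp.weight d x)) →
      classRep d x ∈ hfin.toFinset := by
    intro x hx hn
    have h1 := sameClass_classRep (d := d) x
    rw [hmem, h1.weight_eq]
    exact ⟨hx, fun h => hn (h1.symm.trans h), h1.classRep_eq⟩
  -- vectors of smaller weight in `T` have support disjoint from the members of the family
  have hlt : ∀ u v, Finsupp.weight d u ∈ T → v ∈ hfin.toFinset →
      Finsupp.weight d u ≠ Finsupp.weight d v → sLE S (Finsupp.weight d u) (Finsupp.weight d v) →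
      SuppDisjoint u v := by
    intro u v hu hv hne hle
    obtain ⟨hvT, hvn, -⟩ := (hmem v).mp hv
    obtain ⟨n, hn, hun⟩ := hle
    obtain ⟨ρ, rfl⟩ := hsurj n hn
    have hρ := exists_ne_zero_of_weight_ne_zero (d := d) (z := ρ) (by omega)
    rw [← map_add] at hun
    -- `u + ρ` lies in the distinguished class of the weight of `v`; an index common to `u` and `v`
    -- would put `v` there too.
    have h1 := hdist _ hvT u ρ hu hρ hun
    intro i
    by_contra hi
    push Not at hi
    refine hvn (SameClass.trans (.rel _ _ ⟨hun.symm, i, hi.2, ?_⟩) h1)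
    simp only [Finsupp.add_apply]
    omega
  have hV0 : ∀ v ∈ hfin.toFinset, v ≠ 0 := by
    rintro v hv rfl
    exact hT0 (by simpa using ((hmem 0).mp hv).1)
  have hdis : ∀ u ∈ hfin.toFinset, ∀ v ∈ hfin.toFinset, u ≠ v → SuppDisjoint u v := by
    intro u hu v hv hne
    obtain ⟨huT, hun, hur⟩ := (hmem u).mp hu
    obtain ⟨hvT, hvn, hvr⟩ := (hmem v).mp hv
    rcases eq_or_ne (Finsupp.weight d u) (Finsupp.weight d v) with heq | hneq
    · refine suppDisjoint_of_not_sameClass heq fun h => hne ?_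
      rw [← hur, ← hvr, h.classRep_eq]
    · rcases hchain huT hvT hneq with h | h
      · exact hlt u v huT hv hneq h
      · exact (hlt v u hvT hu hneq.symm h).symm
  have hwV : ∀ v ∈ hfin.toFinset, Finsupp.weight d (w₀ (Finsupp.weight d v)) =
      Finsupp.weight d v := fun v hv => hw _ ((hmem v).mp hv).1
  have hw₀dis : ∀ v ∈ hfin.toFinset, ∀ u ∈ hfin.toFinset,
      Finsupp.weight d v ≤ Finsupp.weight d u → SuppDisjoint (w₀ (Finsupp.weight d v)) u := by
    intro v hv u hu hle
    obtain ⟨hvT, -, -⟩ := (hmem v).mp hv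
    obtain ⟨huT, hun, -⟩ := (hmem u).mp hu
    rcases eq_or_ne (Finsupp.weight d v) (Finsupp.weight d u) with heq | hneq
    · rw [heq]
      exact (suppDisjoint_of_not_sameClass (hw _ huT).symm hun).symm
    · refine hlt _ u ?_ hu ?_ ?_
      · rwa [hw _ hvT]
      · rwa [hw _ hvT]
      · rw [hw _ hvT]
        rcases hchain hvT huT hneq with h | ⟨n, -, h⟩
        · exact h
        · omega
  obtain ⟨W, hW⟩ := exists_decreasing_weight hd hwV hV0 hw₀dis
  refine ⟨hfin.toFinset, hV0, hdis, fun t ht hts => ?_, ?_⟩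
  · obtain ⟨z, hz⟩ := hsurj t ht
    obtain ⟨z₀, hz₀, hav⟩ := exists_avoids_weight_eq hwV hW z
    rw [Set.ncard_eq_one]
    refine ⟨z₀, Set.eq_singleton_iff_unique_mem.mpr ⟨⟨hz₀.trans hz, hav⟩, fun y hy => ?_⟩⟩
    obtain ⟨c, h1, h2⟩ := join_of_weight_eq (w₀ := w₀) hd hdS hdis (by
      intro x x' hxx' hxs hn
      by_cases hx : SameClass d x (w₀ (Finsupp.weight d x))
      · exact Or.inl hx
      · exact Or.inr ⟨_, hrep x ⟨⟨x, x', rfl, hxx'.symm, hn⟩, hxs⟩ hx,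
          (sameClass_classRep x).symm⟩) t hts y z₀ hy.1 (hz₀.trans hz)
    rw [hy.2.eq_of_reflTransGen h1, hav.eq_of_reflTransGen h2]
  · constructor
    · rintro ⟨v, hv⟩
      obtain ⟨hv, rfl⟩ := Finset.mem_filter.mp hv
      exact ((hmem v).mp hv).1.1
    · intro hs
      have hsT : s ∈ T := ⟨hs, 0, zero_mem _, add_zero s⟩
      obtain ⟨z, z', hz, hz', hn⟩ := hs
      have : ∃ x, Finsupp.weight d x = s ∧ ¬ SameClass d x (w₀ s) := by
        by_contra hall
        push Not at hall
        exact hn ((hall z hz).trans (hall z' hz').symm)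
      obtain ⟨x, rfl, hx⟩ := this
      exact ⟨classRep d x, Finset.mem_filter.mpr ⟨hrep x hsT hx,
        (sameClass_classRep x).weight_eq⟩⟩

end Classes

/-! ### Specialization to the minimal generators, and the criterion for Betti elements. -/

variable {S : AddSubmonoid ℕ}

/-- The value of a minimal generator. -/
def genValue (S : AddSubmonoid ℕ) (i : minimalGenerators S) : ℕ := i

theorem genValue_ne_zero (i : minimalGenerators S) : genValue S i ≠ 0 := i.2.2.1

theorem genValue_mem (i : minimalGenerators S) : genValue S i ∈ S := i.2.1

theorem weight_genValue (z : minimalGenerators S →₀ ℕ) :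
    Finsupp.weight (genValue S) z = z.sum fun n k => k * (n : ℕ) :=
  Finsupp.weight_apply _ _

theorem minimalGenerators_finite (hS : IsNumericalSemigroup S) :
    (minimalGenerators S).Finite := by
  obtain ⟨c, hc⟩ := hS.bddAbove
  refine (Set.finite_le_nat (2 * c + 2)).subset fun n hn => ?_
  have hmem : ∀ m, c < m → m ∈ S := fun m hm => by
    by_contra h
    exact absurd (hc h) (by omega)
  by_contra hlt
  simp only [Set.mem_ofPred_eq, not_le] at hlt
  exact hn.2.2 (c + 1) (hmem _ (by omega)) (n - (c + 1)) (hmem _ (by omega)) (by omega) (by omega)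
    (by omega)

theorem exists_weight_genValue_eq (n : ℕ) (hn : n ∈ S) :
    ∃ z : minimalGenerators S →₀ ℕ, Finsupp.weight (genValue S) z = n := by
  have hn' : n ∈ AddSubmonoid.closure (minimalGenerators S) := by
    rw [(isLeast_minimalGenerators S).1]
    exact hn
  induction hn' using AddSubmonoid.closure_induction with
  | mem x hx =>
    exact ⟨Finsupp.single ⟨x, hx⟩ 1, by rw [Finsupp.weight_single, one_smul]; rfl⟩
  | zero => exact ⟨0, map_zero _⟩
  | add x y hx hy ihx ihy =>
    rw [(isLeast_minimalGenerators S).1] at hx hy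
    obtain ⟨u, rfl⟩ := ihx hx
    obtain ⟨v, rfl⟩ := ihy hy
    exact ⟨u + v, map_add _ _ _⟩

theorem reachable_of_sameClass {u v : minimalGenerators S →₀ ℕ}
    (h : SameClass (genValue S) u v) (s : ℕ) (hu : (u.sum fun n k => k * (n : ℕ)) = s)
    (hv : (v.sum fun n k => k * (n : ℕ)) = s) :
    (factorizationGraph S s).Reachable ⟨u, hu⟩ ⟨v, hv⟩ := by
  induction h with
  | rel x y h =>
    by_cases hxy : x = y
    · subst hxy
      exact SimpleGraph.Reachable.refl _
    · exact SimpleGraph.Adj.reachable ⟨fun h' => hxy (congrArg Subtype.val h'), h.2⟩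
  | refl x => exact SimpleGraph.Reachable.refl _
  | symm x y _ ih => exact (ih hv hu).symm
  | trans x y z h _ ih ih' =>
    have hy : (y.sum fun n k => k * (n : ℕ)) = s := by
      rw [← weight_genValue, ← SameClass.weight_eq h, weight_genValue, hu]
    exact (ih hu hy).trans (ih' hy hv)

theorem sameClass_of_reachable {s : ℕ} {x y : Factorization S s}
    (h : (factorizationGraph S s).Reachable x y) : SameClass (genValue S) x.1 y.1 := by
  rw [SimpleGraph.reachable_iff_reflTransGen] at h
  induction h with
  | refl => exact .refl _
  | @tail b c _ hbc ih =>
    refine ih.trans (.rel _ _ ⟨?_, hbc.2⟩)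
    rw [weight_genValue, weight_genValue]
    exact b.2.trans c.2.symm

theorem bettiElements_eq_splitElements (S : AddSubmonoid ℕ) :
    bettiElements S = splitElements (genValue S) := by
  ext s
  constructor
  · rintro ⟨hs, hn⟩
    obtain ⟨z, hz⟩ := exists_weight_genValue_eq s hs
    rw [SimpleGraph.connected_iff, not_and_or] at hn
    rcases hn with hn | hn
    · simp only [SimpleGraph.Preconnected, not_forall] at hn
      obtain ⟨x, y, hxy⟩ := hn
      exact ⟨x.1, y.1, (weight_genValue _).trans x.2, (weight_genValue _).trans y.2,
        fun h => hxy (reachable_of_sameClass h s x.2 y.2)⟩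
    -- Connectedness also requires a vertex, which `s ∈ S` provides.
    · exact absurd ⟨⟨z, (weight_genValue z).symm.trans hz⟩⟩ hn
  · rintro ⟨z, z', hz, hz', hn⟩
    refine ⟨hz ▸ weight_mem genValue_mem z, fun hc => hn ?_⟩
    exact sameClass_of_reachable (hc.preconnected ⟨z, (weight_genValue z).symm.trans hz⟩
      ⟨z', (weight_genValue z').symm.trans hz'⟩)

theorem coeff_hilbertSeries_of_mem {n : ℕ} (hn : n ∈ S) :
    PowerSeries.coeff n (hilbertSeries S) = 1 := by
  simp [hilbertSeries, hn]

theorem coeff_hilbertSeries_of_notMem {n : ℕ} (hn : n ∉ S) :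
    PowerSeries.coeff n (hilbertSeries S) = 0 := by
  simp [hilbertSeries, hn]

theorem exponentSet_eq (S : AddSubmonoid ℕ) :
    exponentSet S = {d | 2 ≤ d ∧ hilbertExponent S d ≠ 0 ∧ d ∉ minimalGenerators S} := by
  ext d
  simp only [exponentSet, Set.mem_ofPred_eq]
  refine and_congr_right fun hd => and_congr_left fun _ => ?_
  have h0 : 0 < d := by omega
  have h1 : d ≠ 1 := by omega
  simp only [hilbertExponent, h0, h1, dite_true, if_false, sub_zero]
  constructor
  · rintro ⟨j, rfl, hj⟩
    exact hj
  · exact fun h => ⟨⟨d, h0⟩, rfl, h⟩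

theorem exponentSet_subset (S : AddSubmonoid ℕ) : exponentSet S ⊆ S := by
  rw [exponentSet_eq]
  exact fun d hd => mem_of_exponent_ne_zero (coeff_hilbertSeries_of_mem (zero_mem S))
    (fun _ => coeff_hilbertSeries_of_notMem) (isLogDeriv_hilbertSeries S) d (by have := hd.1; omega)
    hd.2.1

/-- If the Betti elements below `s` form a chain, then `s` is a Betti element if and only if it lies
in the exponent set. -/
theorem mem_exponentSet_iff (hS : IsNumericalSemigroup S) {s : ℕ} (hs : s ∈ S) (hs2 : 2 ≤ s)
    (hgen : s ∉ minimalGenerators S)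
    (hchain : IsChain (sLE S) {b | b ∈ bettiElements S ∧ sLE S b s}) :
    s ∈ exponentSet S ↔ s ∈ bettiElements S := by
  have := (minimalGenerators_finite hS).fintype
  rw [bettiElements_eq_splitElements] at hchain ⊢
  obtain ⟨V, hV0, hdis, hcount, hsV⟩ := exists_avoiding_family genValue_ne_zero genValue_mem
    exists_weight_genValue_eq s hchain
  rw [exponentSet_eq, ← hsV]
  have h0 : sLE S 0 s := ⟨s, hs, zero_add s⟩
  have hexp := exponent_congr (F := hilbertSeries S) (F' := avoidingSeries (genValue S) V)
    (coeff_hilbertSeries_of_mem (zero_mem S))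
    (by rw [avoidingSeries, PowerSeries.coeff_mk, hcount 0 (zero_mem S) h0, Nat.cast_one])
    (fun _ => coeff_hilbertSeries_of_notMem)
    (fun n hn => by
      have : {z | Finsupp.weight (genValue S) z = n ∧ Avoids V z} = ∅ :=
        Set.eq_empty_of_forall_notMem fun z hz => hn (hz.1 ▸ weight_mem genValue_mem z)
      rw [avoidingSeries, PowerSeries.coeff_mk, this, Set.ncard_empty, Nat.cast_zero])
    (isLogDeriv_hilbertSeries S) (isLogDeriv_avoidingSeries genValue_ne_zero V hV0 hdis)
    (fun t ht hts => by
      rw [coeff_hilbertSeries_of_mem ht, avoidingSeries, PowerSeries.coeff_mk, hcount t ht hts,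
        Nat.cast_one])
    s (by omega) hs ⟨0, zero_mem S, add_zero s⟩
  -- As `s` is not a generator, the denominator contributes nothing to the exponent at `s`.
  have hempty : (Finset.univ.filter fun i => genValue S i = s) = ∅ :=
    Finset.filter_eq_empty_iff.mpr fun i _ hi => hgen (hi ▸ i.2)
  rw [hempty, Finset.card_empty, Nat.cast_zero, sub_zero] at hexp
  rw [Set.mem_ofPred_eq, hexp, Nat.cast_ne_zero, Finset.card_ne_zero]
  exact ⟨fun h => h.2.1, fun h => ⟨hs2, h, hgen⟩⟩

/-- A minimal generator has only one factorization, its unit vector. -/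
theorem notMem_minimalGenerators_of_mem_bettiElements {b : ℕ} (hb : b ∈ bettiElements S) :
    b ∉ minimalGenerators S := by
  rw [bettiElements_eq_splitElements] at hb
  intro hg
  have huniq : ∀ z : minimalGenerators S →₀ ℕ, Finsupp.weight (genValue S) z = b →
      z = Finsupp.single ⟨b, hg⟩ 1 := by
    rintro z rfl
    obtain ⟨i, hi⟩ := exists_ne_zero_of_weight_ne_zero hg.2.1
    have ez : z - Finsupp.single i 1 + Finsupp.single i 1 = z :=
      tsub_add_cancel_of_le (by simpa [Finsupp.single_le_iff, Nat.one_le_iff_ne_zero] using hi)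
    have hw := congrArg (Finsupp.weight (genValue S)) ez
    rw [map_add, Finsupp.weight_single, one_smul] at hw
    by_cases h0 : Finsupp.weight (genValue S) (z - Finsupp.single i 1) = 0
    · rw [eq_zero_of_weight_eq_zero genValue_ne_zero h0, zero_add] at ez
      rw [h0, zero_add] at hw
      have : i = ⟨_, hg⟩ := Subtype.ext hw
      rw [← this, ez]
    · exact absurd hw (hg.2.2 _ (weight_mem genValue_mem _) _ (genValue_mem i) h0
        (genValue_ne_zero i))
  obtain ⟨z, z', hz, hz', hn⟩ := hb
  exact hn (by rw [huniq z hz, huniq z' hz']; exact .refl _)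

theorem two_le_of_mem_bettiElements {b : ℕ} (hb : b ∈ bettiElements S) : 2 ≤ b := by
  have h0 : b ≠ 0 := by
    rintro rfl
    rw [bettiElements_eq_splitElements] at hb
    exact zero_notMem_splitElements genValue_ne_zero hb
  have h1 : b ≠ 1 := by
    rintro rfl
    exact notMem_minimalGenerators_of_mem_bettiElements hb
      ⟨hb.1, one_ne_zero, fun a _ b _ ha hb => by omega⟩
  omega

theorem bettiElements_eq_exponentSet (hS : IsNumericalSemigroup S) (h : IsBettiSorted S) :
    bettiElements S = exponentSet S := by
  have hsub : ∀ s, IsChain (sLE S) {b | b ∈ bettiElements S ∧ sLE S b s} := fun s =>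
    h.mono fun b hb => hb.1
  ext b
  constructor
  · exact fun hb => (mem_exponentSet_iff hS hb.1 (two_le_of_mem_bettiElements hb)
      (notMem_minimalGenerators_of_mem_bettiElements hb) (hsub b)).mpr hb
  · exact fun hb => (mem_exponentSet_iff hS (exponentSet_subset S hb) hb.1 hb.2.2 (hsub b)).mp hb

/-- By strong induction the Betti elements strictly below `b` lie in the exponent set, hence form a
chain; adding `b` on top keeps it a chain, so the criterion applies to `b`. -/
theorem isBettiSorted_of_isChain (hS : IsNumericalSemigroup S)
    (h : IsChain (sLE S) (exponentSet S)) : IsBettiSorted S := by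
  have hsub : ∀ b, b ∈ bettiElements S → b ∈ exponentSet S := by
    intro b
    induction b using Nat.strong_induction_on with
    | _ b ih =>
      intro hb
      have hlt : ∀ x, x ∈ bettiElements S → sLE S x b → x ≠ b → x ∈ exponentSet S := by
        rintro x hx ⟨n, -, hn⟩ hxb
        exact ih x (by omega) hx
      refine (mem_exponentSet_iff hS hb.1 (two_le_of_mem_bettiElements hb)
        (notMem_minimalGenerators_of_mem_bettiElements hb) ?_).mpr hb
      rintro x ⟨hx, hxb⟩ y ⟨hy, hyb⟩ hxy
      rcases eq_or_ne x b with rfl | hxb'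
      · exact Or.inr hyb
      rcases eq_or_ne y b with rfl | hyb'
      · exact Or.inl hxb
      exact h (hlt x hx hxb hxb') (hlt y hy hyb hyb') hxy
  exact h.mono hsub

theorem isChain_sLE_of_isChain_dvd {A : Set ℕ} (hAS : A ⊆ S) (hA0 : 0 ∉ A)
    (h : IsChain (· ∣ ·) A) : IsChain (sLE S) A := by
  have key : ∀ x ∈ A, ∀ y ∈ A, x ∣ y → sLE S x y := by
    rintro x hx _ hy ⟨k, rfl⟩
    obtain ⟨k, rfl⟩ := Nat.exists_eq_succ_of_ne_zero (n := k) (by rintro rfl; exact hA0 hy)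
    exact ⟨k * x, by simpa using nsmul_mem (hAS hx) k, by simp only [Nat.succ_eq_add_one]; ring⟩
  intro x hx y hy hxy
  exact (h hx hy hxy).imp (key x hx y hy) (key y hy x hx)

end NumSgp

theorem theorem3 (S : AddSubmonoid ℕ) (hS : NumSgp.IsNumericalSemigroup S) :
    (NumSgp.IsBettiSorted S ↔ IsChain (NumSgp.sLE S) (NumSgp.exponentSet S)) ∧
    (NumSgp.IsBettiSorted S → NumSgp.bettiElements S = NumSgp.exponentSet S) ∧
    (NumSgp.IsBettiDivisible S ↔ IsChain (· ∣ ·) (NumSgp.exponentSet S)) ∧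
    ((∃ b, NumSgp.bettiElements S = {b}) ↔ (∃ d, NumSgp.exponentSet S = {d})) := by
  have heq := NumSgp.bettiElements_eq_exponentSet hS
  have hsorted := NumSgp.isBettiSorted_of_isChain hS
  refine ⟨⟨fun h => heq h ▸ h, hsorted⟩, heq, ⟨fun h => ?_, fun h => ?_⟩, ?_, ?_⟩
  · have h' : NumSgp.IsBettiSorted S := NumSgp.isChain_sLE_of_isChain_dvd (fun b hb => hb.1)
      (fun h0 => absurd (NumSgp.two_le_of_mem_bettiElements h0) (by omega)) h
    exact heq h' ▸ h
  · have h' := hsorted (NumSgp.isChain_sLE_of_isChain_dvd (NumSgp.exponentSet_subset S)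
      (fun h0 => absurd h0.1 (by omega)) h)
    rw [NumSgp.IsBettiDivisible, heq h']
    exact h
  · rintro ⟨b, hb⟩
    have h' : NumSgp.IsBettiSorted S := by
      rw [NumSgp.IsBettiSorted, hb]
      exact Set.subsingleton_singleton.isChain
    exact ⟨b, heq h' ▸ hb⟩
  · rintro ⟨d, hd⟩
    have h' := hsorted (by rw [hd]; exact Set.subsingleton_singleton.isChain)
    exact ⟨d, (heq h').trans hd⟩
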